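/- Let $k\ge 1$ be an integer and let $\alpha>1$ be a real number. Let $(\mathbf{x}_n)_{n}$, $\mathbf{x}_n=(x_{n,1},\dots,x_{n,k})$, be a sequence of points in $[0,1]^k$, and let $(r_n^1)_n,\dots,(r_n^k)_n$ be sequences of positive real numbers with $r_n^1\to 0$ as $n\to\infty$. For $c\in\mathbb{R}$ and $\rho>0$ let $B(c,\rho)$ be the interval in $\mathbb{R}$ with centre $c$ and radius $\rho$ (either always the open or always the closed one; the result holds for both choices). Put \[H_n=\prod_{i=1}^k B(x_{n,i},r_n^i),\qquad h_n=B\bigl(x_{n,1},(r_n^1)^{\alpha}\bigr)\times\prod_{i=2}^k B(x_{n,i},r_n^i),\] and write $\limsup_{n\to\infty}A_n=\bigcap_{m}\bigcup_{n\ge m}A_n$. Suppose that $[0,1]^k\cap\limsup_{n\to\infty}H_n$ has $k$-dimensional Lebesgue measure $1$. (If all $H_n$ are contained in $[0,1]^k$, the intersection with $[0,1]^k$ is redundant.) Then \[\dim_{\mathrm H}\Bigl([0,1]^k\cap\limsup_{n\to\infty}h_n\Bigr)\ \ge\ \frac1\alpha+k-1,\] where $\dim_{\mathrm H}$ denotes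 Hausdorff dimension with respect to the Euclidean metric; in particular $\dim_{\mathrm H}(\limsup_{n\to\infty}h_n)\ge\frac1\alpha+k-1$. -/

import Mathlib

open Filter Topology MeasureTheory

/-- The unit cube `[0,1]^k` in Euclidean space `ℝ^k`. -/
def unitCube (k : ℕ) : Set (EuclideanSpace ℝ (Fin k)) :=
  {y | ∀ i, y i ∈ Set.Icc (0 : ℝ) 1}

/-- The rectangle `∏ i, B(x i, r i)` in `ℝ^k`, with open intervals `B(c, ρ) = (c - ρ, c + ρ)`. -/
def rectangle {k : ℕ} (x : EuclideanSpace ℝ (Fin k)) (r : Fin k → ℝ) :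
    Set (EuclideanSpace ℝ (Fin k)) :=
  {y | ∀ i, y i ∈ Metric.ball (x i) (r i)}

/-- The rectangle `∏ i, B(x i, r i)` in `ℝ^k`, with closed intervals `B(c, ρ) = [c - ρ, c + ρ]`. -/
def closedRectangle {k : ℕ} (x : EuclideanSpace ℝ (Fin k)) (r : Fin k → ℝ) :
    Set (EuclideanSpace ℝ (Fin k)) :=
  {y | ∀ i, y i ∈ Metric.closedBall (x i) (r i)}

/-- The side radii obtained from `r` by replacing the first one, `r 0`, by `(r 0) ^ α`. -/
noncomputable def shrinkFirst {k : ℕ} [NeZero k] (α : ℝ) (r : Fin k → ℝ) : Fin k → ℝ :=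
  Function.update r 0 ((r 0) ^ α)

/-!
Fix all coordinates but the first. By Fubini, on almost every line of the unit cube in the direction
of the first coordinate, almost every point lies in infinitely many of the traces of the rectangles,
which are intervals `B(x n, r n)` with `r n → 0`. It then suffices to know that the points
of such a line lying in infinitely many of the intervals `B(x n, (r n) ^ α)` have dimension at least
`1 / α`, in a quantitative form that survives integration over the remaining coordinates.

The one-dimensional form is `exists_mem_limsup_ball_notMem`: for `s < 1 / α` there is `c > 0`
such that no family of intervals whose radii satisfy `∑ ρ ^ s < c` covers the limsup set. No
Cantor set or measure is constructed. Call an interval `J` good if the traces of the cover on `J`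
satisfy `∑ |U j ∩ J| ^ s ≤ c |J| ^ s`. A good interval contains a good interval of the form
`closedBall (x n) ((r n) ^ α / 2)` with `n` as large as desired (`IsThinOn.exists_closedBall`):
Vitali's lemma provides disjoint balls `closedBall (x i) (r i)` in `J` filling a fixed proportion of
`J`, and if none of the shrunken balls were good, summing with weights `(r i) ^ (1 - α s)` would
contradict a bound for each interval of the cover separately (`sum_rpow_volume_ball_inter_le`).
The good intervals so obtained shrink to a point that lies in infinitely many
`B(x n, (r n) ^ α)`, and in no `U j`, since a good interval is contained in no `U j`.

For the passage to higher dimension (`le_dimH_limsup_prod`), suppose that the `(s + m)`-dimensional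
Hausdorff measure of the limsup set in `ℝ^(m+1)` is zero. It has a cover by balls with
`∑ ρ ^ (s + m)` small. The integral over the slices of the sum of `ρ ^ s` over the balls that meet
the slice is at most `2 ^ m ∑ ρ ^ (s + m)`, so some slice is covered more cheaply than the
one-dimensional result allows. Open and closed rectangles are treated together: the one-dimensional
result starts from closed balls and ends in open ones, and the sets in the other coordinates are
arbitrary, since they only decide which indices belong to a slice.
-/

/-! ### Intervals crossing disjoint balls -/

/-- An interval `(a - ρ, a + ρ)` that meets the ball of radius `b ≤ r / 2` about `x` and leaves the
concentric ball of radius `r` crosses the annulus in between, hence has a trace of length at least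
`r / 2` on the larger ball. -/
lemma le_two_mul_volume_ball_inter_closedBall {a ρ x b r : ℝ} (hb : b ≤ r / 2) {y z : ℝ}
    (hy : y ∈ Metric.ball a ρ) (hyx : y ∈ Metric.closedBall x b)
    (hz : z ∈ Metric.ball a ρ) (hzx : z ∉ Metric.closedBall x r) :
    r ≤ 2 * volume.real (Metric.ball a ρ ∩ Metric.closedBall x r) := by
  have hfin : volume (Metric.ball a ρ ∩ Metric.closedBall x r) ≠ ⊤ :=
    ((measure_mono Set.inter_subset_left).trans_lt measure_ball_lt_top).ne
  rw [Real.ball_eq_Ioo, Set.mem_Ioo] at hy hz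
  rw [Real.closedBall_eq_Icc, Set.mem_Icc] at hyx
  rw [Real.closedBall_eq_Icc, Set.mem_Icc, not_and_or, not_le, not_le] at hzx
  rw [Real.ball_eq_Ioo, Real.closedBall_eq_Icc] at hfin ⊢
  rcases hzx with h | h
  · have hsub : Set.Icc (x - r) y ⊆ Set.Ioo (a - ρ) (a + ρ) ∩ Set.Icc (x - r) (x + r) := by
      rintro w ⟨h1, h2⟩
      refine ⟨⟨?_, ?_⟩, ?_, ?_⟩ <;> linarith
    have := measureReal_mono hsub hfin
    rw [Real.volume_real_Icc] at this
    linarith [le_max_left (y - (x - r)) 0]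
  · have hsub : Set.Icc y (x + r) ⊆ Set.Ioo (a - ρ) (a + ρ) ∩ Set.Icc (x - r) (x + r) := by
      rintro w ⟨h1, h2⟩
      refine ⟨⟨?_, ?_⟩, ?_, ?_⟩ <;> linarith
    have := measureReal_mono hsub hfin
    rw [Real.volume_real_Icc] at this
    linarith [le_max_left (x + r - y) 0]

/-- The basic estimate for one interval `U = (a - ρ, a + ρ)` of a cover, with respect to disjoint
balls `closedBall (x i) (r i)` inside `J`, on whose concentric balls of radius `(r i) ^ α / 2` a
mass proportional to `r i` is spread. Either `U` meets at most one of the small balls, or it crosses a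
fixed proportion of every ball whose small ball it meets. -/
lemma sum_rpow_volume_ball_inter_le {α s a ρ η : ℝ} {J : Set ℝ} (hα : 1 < α) (hs : 0 < s)
    {T : Finset ℕ} {x r : ℕ → ℝ}
    (hr : ∀ i ∈ T, 0 < r i) (hr1 : ∀ i ∈ T, r i ≤ 1)
    (hη : ∀ i ∈ T, r i ^ (1 - α * s) ≤ η)
    (hJ : ∀ i ∈ T, Metric.closedBall (x i) (r i) ⊆ J)
    (hd : (T : Set ℕ).PairwiseDisjoint fun i => Metric.closedBall (x i) (r i)) (hη0 : 0 ≤ η) :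
    ∑ i ∈ T, r i ^ (1 - α * s) *
        volume.real (Metric.ball a ρ ∩ Metric.closedBall (x i) (r i ^ α / 2)) ^ s ≤
      2 * volume.real (Metric.ball a ρ ∩ J) + η * volume.real (Metric.ball a ρ ∩ J) ^ s := by
  set U := Metric.ball a ρ with hU
  have hfin : ∀ A : Set ℝ, volume (U ∩ A) ≠ ⊤ := fun A =>
    ((measure_mono Set.inter_subset_left).trans_lt measure_ball_lt_top).ne
  have hb : ∀ i ∈ T, r i ^ α / 2 ≤ r i / 2 := fun i hi => by
    have := Real.rpow_le_rpow_of_exponent_ge (hr i hi) (hr1 i hi) hα.le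
    rw [Real.rpow_one] at this
    linarith
  have hsm : ∀ i ∈ T, Metric.closedBall (x i) (r i ^ α / 2) ⊆ Metric.closedBall (x i) (r i) :=
    fun i hi => Metric.closedBall_subset_closedBall (by linarith [hb i hi, hr i hi])
  have h2 : 0 ≤ 2 * volume.real (U ∩ J) := by positivity
  have h3 : 0 ≤ η * volume.real (U ∩ J) ^ s := by positivity
  have hzero : ∀ i ∈ T, ¬ (U ∩ Metric.closedBall (x i) (r i ^ α / 2)).Nonempty →
      r i ^ (1 - α * s) * volume.real (U ∩ Metric.closedBall (x i) (r i ^ α / 2)) ^ s = 0 := by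
    intro i _ h
    rw [Set.not_nonempty_iff_eq_empty.1 h]
    simp [Real.zero_rpow hs.ne']
  by_cases hone : ∃ i ∈ T, (U ∩ Metric.closedBall (x i) (r i ^ α / 2)).Nonempty ∧
      ∀ j ∈ T, j ≠ i → ¬ (U ∩ Metric.closedBall (x j) (r j ^ α / 2)).Nonempty
  · obtain ⟨i, hi, -, hother⟩ := hone
    rw [Finset.sum_eq_single_of_mem i hi fun j hj hji => hzero j hj (hother j hj hji)]
    have : volume.real (U ∩ Metric.closedBall (x i) (r i ^ α / 2)) ^ s ≤
        volume.real (U ∩ J) ^ s :=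
      Real.rpow_le_rpow measureReal_nonneg (measureReal_mono
        (Set.inter_subset_inter_right _ ((hsm i hi).trans (hJ i hi))) (hfin _)) hs.le
    have := mul_le_mul (hη i hi) this (by positivity) hη0
    linarith
  · push Not at hone
    have hterm : ∀ i ∈ T, r i ^ (1 - α * s) *
        volume.real (U ∩ Metric.closedBall (x i) (r i ^ α / 2)) ^ s ≤
          2 * volume.real (U ∩ Metric.closedBall (x i) (r i)) := by
      intro i hi
      by_cases hne : (U ∩ Metric.closedBall (x i) (r i ^ α / 2)).Nonempty
      · obtain ⟨j, hj, hji, hne'⟩ := hone i hi hne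
        obtain ⟨y, hyU, hy⟩ := hne
        obtain ⟨z, hzU, hz⟩ := hne'
        have hz' : z ∉ Metric.closedBall (x i) (r i) := fun h =>
          Set.disjoint_left.1 (hd hj hi hji) (hsm j hj hz) h
        refine le_trans ?_ (le_two_mul_volume_ball_inter_closedBall (hb i hi) hyU hy hzU hz')
        have hpos := hr i hi
        have hle : volume.real (U ∩ Metric.closedBall (x i) (r i ^ α / 2)) ≤ r i ^ α := by
          have := measureReal_mono (μ := volume) (Set.inter_subset_right
            (s := U) (t := Metric.closedBall (x i) (r i ^ α / 2))) measure_closedBall_lt_top.ne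
          rwa [Real.volume_real_closedBall (by positivity), mul_div_cancel₀ _ two_ne_zero] at this
        calc _ ≤ r i ^ (1 - α * s) * (r i ^ α) ^ s := by gcongr
          _ = r i := by
            rw [← Real.rpow_mul hpos.le, ← Real.rpow_add hpos]; simp
      · rw [hzero i hi hne]; positivity
    have hdis : ∑ i ∈ T, volume.real (U ∩ Metric.closedBall (x i) (r i)) ≤
        volume.real (U ∩ J) := by
      rw [← measureReal_biUnion_finset
        (fun i hi j hj hij => (hd hi hj hij).mono Set.inter_subset_right Set.inter_subset_right)
        (fun i _ => measurableSet_ball.inter measurableSet_closedBall) (fun i _ => hfin _)]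
      exact measureReal_mono (Set.iUnion₂_subset fun i hi =>
        Set.inter_subset_inter_right _ (hJ i hi)) (hfin _)
    calc _ ≤ ∑ i ∈ T, 2 * volume.real (U ∩ Metric.closedBall (x i) (r i)) :=
          Finset.sum_le_sum hterm
      _ = 2 * ∑ i ∈ T, volume.real (U ∩ Metric.closedBall (x i) (r i)) :=
          (Finset.mul_sum ..).symm
      _ ≤ _ := by linarith

/-- Disjoint balls of a limsup set of full measure, of arbitrarily high index, fill a fixed
proportion of a given interval. -/
lemma exists_finset_disjoint_closedBall {x r : ℕ → ℝ} (hr : ∀ n, 0 < r n)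
    (hr0 : Tendsto r atTop (𝓝 0)) {S : Set ℕ} {p R : ℝ} (hR : 0 < R)
    (hfull : ∀ᵐ t : ℝ, t ∈ Metric.closedBall p R →
      ∃ᶠ n in atTop, n ∈ S ∧ t ∈ Metric.closedBall (x n) (r n)) (N : ℕ) :
    ∃ T : Finset ℕ, (∀ i ∈ T, i ∈ S ∧ N ≤ i ∧
        Metric.closedBall (x i) (r i) ⊆ Metric.closedBall p R) ∧
      (T : Set ℕ).PairwiseDisjoint (fun i => Metric.closedBall (x i) (r i)) ∧
      R / 10 < ∑ i ∈ T, r i := by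
  obtain ⟨N', hN'⟩ := (hr0.eventually (eventually_le_nhds one_pos)).exists_forall_of_atTop
  set t : Set ℕ := {i | i ∈ S ∧ max N N' ≤ i ∧
    Metric.closedBall (x i) (r i) ⊆ Metric.closedBall p R}
  obtain ⟨u, hut, hdis, hcov⟩ := Vitali.exists_disjoint_subfamily_covering_enlargement_closedBall
    t x r 1 (fun i hi => hN' i ((le_max_right _ _).trans hi.2.1)) 5 (by norm_num)
  have hae : Metric.ball p R ≤ᵐ[volume] (⋃ i ∈ u, Metric.closedBall (x i) (5 * r i) : Set ℝ) := by
    filter_upwards [hfull] with y hy hyJ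
    have hyJ' : y ∈ Metric.ball p R := hyJ
    obtain ⟨ε, hε, hsub⟩ := Metric.isOpen_iff.1 Metric.isOpen_ball y hyJ'
    have hev : ∀ᶠ n in atTop, max N N' ≤ n ∧ r n < ε / 2 :=
      (eventually_ge_atTop _).and (hr0.eventually (eventually_lt_nhds (by positivity)))
    obtain ⟨n, ⟨hnS, hyn⟩, hNn, hrn⟩ :=
      ((hy (Metric.ball_subset_closedBall hyJ')).and_eventually hev).exists
    have hnt : n ∈ t := by
      refine ⟨hnS, hNn, fun z hz => Metric.ball_subset_closedBall (hsub ?_)⟩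
      have h1 := Metric.mem_closedBall.1 hz
      have h2 := Metric.mem_closedBall'.1 hyn
      have := dist_triangle z (x n) y
      exact Metric.mem_ball.2 (by linarith)
    obtain ⟨b, hb, hnb⟩ := hcov n hnt
    exact Set.mem_iUnion₂.2 ⟨b, hb, hnb hyn⟩
  have hle : ENNReal.ofReal (2 * R) ≤ ∑' i : u, ENNReal.ofReal (10 * r i) := by
    calc ENNReal.ofReal (2 * R) = volume (Metric.ball p R) := (Real.volume_ball _ _).symm
      _ ≤ volume (⋃ i ∈ u, Metric.closedBall (x i) (5 * r i)) := measure_mono_ae hae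
      _ ≤ ∑' i : u, volume (Metric.closedBall (x i) (5 * r i)) :=
          measure_biUnion_le _ u.to_countable _
      _ = _ := by
          congr 1; ext i; rw [Real.volume_closedBall]; congr 1; ring
  have hlt : ENNReal.ofReal R < ∑' i : u, ENNReal.ofReal (10 * r i) :=
    lt_of_lt_of_le ((ENNReal.ofReal_lt_ofReal_iff (by positivity)).2 (by linarith)) hle
  rw [ENNReal.tsum_eq_iSup_sum] at hlt
  obtain ⟨T, hT⟩ := lt_iSup_iff.1 hlt
  rw [← ENNReal.ofReal_sum_of_nonneg fun i _ => by linarith [hr i],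
    ENNReal.ofReal_lt_ofReal_iff'] at hT
  refine ⟨T.map (Function.Embedding.subtype _), fun i hi => ?_, ?_, ?_⟩
  · obtain ⟨j, -, rfl⟩ := Finset.mem_map.1 hi
    have := hut j.2
    exact ⟨this.1, (le_max_left _ _).trans this.2.1, this.2.2⟩
  · refine hdis.subset fun i hi => ?_
    obtain ⟨j, -, rfl⟩ := Finset.mem_map.1 (Finset.mem_coe.1 hi)
    exact j.2
  · rw [Finset.sum_map]
    have := hT.1
    rw [← Finset.mul_sum] at this
    simp only [Function.Embedding.subtype_apply]
    linarith

/-! ### Mass transference on the line -/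

/-- The family of intervals `(a j - ρ j, a j + ρ j)` covers the set `J` only thinly: the sum of the
`s`-th powers of the lengths of the traces on `J` is at most `c |J| ^ s`. The sum is
expressed by its finite partial sums. -/
def IsThinOn (s c : ℝ) (a ρ : ℕ → ℝ) (J : Set ℝ) : Prop :=
  ∀ F : Finset ℕ, ∑ j ∈ F, volume.real (Metric.ball (a j) (ρ j) ∩ J) ^ s ≤ c * volume.real J ^ s

/-- A cover thin on an interval is thin on one of the shrunken balls inside it.
Otherwise, adding up over a disjoint family of balls of radii `r i` filling a fixed
proportion of the interval the failures of thinness, with weights `(r i) ^ (1 - α * s)`, contradicts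
`sum_rpow_volume_ball_inter_le`. -/
lemma IsThinOn.exists_closedBall {α s c : ℝ} (hα : 1 < α) (hs : 0 < s) (hαs : α * s < 1)
    (hc : 0 < c) (hc' : c ^ ((1 - s) / s) ≤ 1 / 80) {a ρ x r : ℕ → ℝ} (hr : ∀ n, 0 < r n)
    (hr0 : Tendsto r atTop (𝓝 0)) {S : Set ℕ} {p R : ℝ} (hR : 0 < R)
    (hfull : ∀ᵐ t : ℝ, t ∈ Metric.closedBall p R →
      ∃ᶠ n in atTop, n ∈ S ∧ t ∈ Metric.closedBall (x n) (r n))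
    (hthin : IsThinOn s c a ρ (Metric.closedBall p R)) (N : ℕ) :
    ∃ n, N ≤ n ∧ n ∈ S ∧
      Metric.closedBall (x n) (r n ^ α / 2) ⊆ Metric.closedBall p R ∧
      IsThinOn s c a ρ (Metric.closedBall (x n) (r n ^ α / 2)) := by
  have hs1 : s < 1 := by nlinarith
  set η : ℝ := (2 * R) ^ (1 - s) / 40 with hη
  have hη0 : 0 < η := by positivity
  have hlim : Tendsto (fun n => r n ^ (1 - α * s)) atTop (𝓝 0) := by
    have := hr0.rpow_const (p := 1 - α * s) (Or.inr (by linarith))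
    rwa [Real.zero_rpow (by linarith)] at this
  obtain ⟨N', hN'⟩ := ((hlim.eventually (eventually_le_nhds hη0)).and
    (hr0.eventually (eventually_le_nhds one_pos))).exists_forall_of_atTop
  obtain ⟨T, hT, hdis, hsum⟩ := exists_finset_disjoint_closedBall hr hr0 hR hfull (max N N')
  have hTN' : ∀ i ∈ T, N' ≤ i := fun i hi => (le_max_right _ _).trans (hT i hi).2.1
  by_contra! hcon
  have hbad : ∀ i ∈ T, ∃ F : Finset ℕ, c * r i ^ (α * s) <
      ∑ j ∈ F, volume.real (Metric.ball (a j) (ρ j) ∩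
        Metric.closedBall (x i) (r i ^ α / 2)) ^ s := by
    intro i hi
    obtain ⟨hiS, hiN, hsub⟩ := hT i hi
    have hpos := hr i
    have hle : r i ^ α / 2 ≤ r i := by
      have := Real.rpow_le_rpow_of_exponent_ge hpos (hN' i (hTN' i hi)).2 hα.le
      rw [Real.rpow_one] at this
      linarith
    have := hcon i ((le_max_left _ _).trans hiN) hiS
      ((Metric.closedBall_subset_closedBall hle).trans hsub)
    simp only [IsThinOn, not_forall, not_le] at this
    obtain ⟨F, hF⟩ := this
    refine ⟨F, ?_⟩
    rwa [Real.volume_real_closedBall (by positivity), mul_div_cancel₀ _ two_ne_zero,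
      ← Real.rpow_mul hpos.le] at hF
  choose! F hF using hbad
  set G := T.biUnion F with hG
  set V : ℕ → ℝ := fun j => volume.real (Metric.ball (a j) (ρ j) ∩ Metric.closedBall p R) with hV
  have hVnn : ∀ j, 0 ≤ V j := fun j => measureReal_nonneg
  have hJ : volume.real (Metric.closedBall p R) = 2 * R := Real.volume_real_closedBall hR.le
  have hthinG : ∑ j ∈ G, V j ^ s ≤ c * (2 * R) ^ s := hJ ▸ hthin G
  have hlow : ∀ i ∈ T, c * r i ≤ ∑ j ∈ G, r i ^ (1 - α * s) *
      volume.real (Metric.ball (a j) (ρ j) ∩ Metric.closedBall (x i) (r i ^ α / 2)) ^ s := by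
    intro i hi
    have hpos := hr i
    rw [← Finset.mul_sum]
    calc c * r i = r i ^ (1 - α * s) * (c * r i ^ (α * s)) := by
          rw [mul_left_comm, ← Real.rpow_add hpos]; simp
      _ ≤ _ := by
          gcongr
          refine (hF i hi).le.trans (Finset.sum_le_sum_of_subset_of_nonneg
            (Finset.subset_biUnion_of_mem F hi) fun j _ _ => by positivity)
  -- A single trace is much shorter than the interval, so replacing the exponent `s` by `1` gains
  -- the factor `c ^ ((1 - s) / s)`, which beats the constant in the basic estimate.
  have hup : ∀ j, V j ≤ (2 * R) ^ (1 - s) / 80 * V j ^ s := by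
    intro j
    have h1 : V j ^ s ≤ c * (2 * R) ^ s := by
      have := hthin {j}
      rwa [Finset.sum_singleton, hJ] at this
    rcases (hVnn j).eq_or_lt with h0 | h0
    · rw [← h0, Real.zero_rpow hs.ne', mul_zero]
    have h2 : V j ^ (1 - s) ≤ (2 * R) ^ (1 - s) / 80 := by
      calc V j ^ (1 - s) = (V j ^ s) ^ ((1 - s) / s) := by
            rw [← Real.rpow_mul h0.le, mul_div_cancel₀ _ hs.ne']
        _ ≤ (c * (2 * R) ^ s) ^ ((1 - s) / s) := by
            refine Real.rpow_le_rpow (by positivity) h1 (div_nonneg (by linarith) hs.le)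
        _ = c ^ ((1 - s) / s) * (2 * R) ^ (1 - s) := by
            rw [Real.mul_rpow hc.le (by positivity), ← Real.rpow_mul (by positivity),
              mul_div_cancel₀ _ hs.ne']
        _ ≤ 1 / 80 * (2 * R) ^ (1 - s) := by gcongr
        _ = _ := by ring
    calc V j = V j ^ (1 - s) * V j ^ s := by rw [← Real.rpow_add h0]; simp
      _ ≤ _ := by gcongr
  have hfinal : c * ∑ i ∈ T, r i ≤ c * (R / 10) := by
    calc c * ∑ i ∈ T, r i = ∑ i ∈ T, c * r i := Finset.mul_sum ..
      _ ≤ ∑ i ∈ T, ∑ j ∈ G, r i ^ (1 - α * s) * volume.real (Metric.ball (a j) (ρ j) ∩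
            Metric.closedBall (x i) (r i ^ α / 2)) ^ s := Finset.sum_le_sum hlow
      _ = ∑ j ∈ G, ∑ i ∈ T, r i ^ (1 - α * s) * volume.real (Metric.ball (a j) (ρ j) ∩
            Metric.closedBall (x i) (r i ^ α / 2)) ^ s := Finset.sum_comm
      _ ≤ ∑ j ∈ G, (2 * V j + η * V j ^ s) := Finset.sum_le_sum fun j _ =>
          sum_rpow_volume_ball_inter_le hα hs (fun i _ => hr i)
            (fun i hi => (hN' i (hTN' i hi)).2) (fun i hi => (hN' i (hTN' i hi)).1)
            (fun i hi => (hT i hi).2.2) hdis hη0.le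
      _ ≤ ∑ j ∈ G, (2 * R) ^ (1 - s) / 20 * V j ^ s := Finset.sum_le_sum fun j _ => by
          have := hup j
          rw [hη]; nlinarith
      _ = (2 * R) ^ (1 - s) / 20 * ∑ j ∈ G, V j ^ s := (Finset.mul_sum ..).symm
      _ ≤ (2 * R) ^ (1 - s) / 20 * (c * (2 * R) ^ s) := by gcongr
      _ = c * ((2 * R) ^ (1 - s) * (2 * R) ^ s) / 20 := by ring
      _ = c * (R / 10) := by
          rw [← Real.rpow_add (by positivity)]
          simp only [sub_add_cancel, Real.rpow_one]; ring
  exact absurd (le_of_mul_le_mul_left hfinal hc) (not_le.2 hsum)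

/-- A quantitative one-dimensional mass transference principle: the points of `[0,1]` that lie in
infinitely many shrunken balls have `s`-dimensional Hausdorff content bounded below by a constant
that depends on `s` only. -/
theorem exists_mem_limsup_ball_notMem {α s : ℝ} (hα : 1 < α) (hs : 0 < s) (hαs : α * s < 1) :
    ∃ c > 0, ∀ (x r : ℕ → ℝ) (S : Set ℕ), (∀ n, 0 < r n) → Tendsto r atTop (𝓝 0) →
      (∀ᵐ t : ℝ, t ∈ Set.Icc (0 : ℝ) 1 →
        ∃ᶠ n in atTop, n ∈ S ∧ t ∈ Metric.closedBall (x n) (r n)) →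
      ∀ a ρ : ℕ → ℝ, (∀ j, 0 ≤ ρ j) → ∑' j, ENNReal.ofReal (ρ j ^ s) < ENNReal.ofReal c →
        ∃ t ∈ Set.Icc (0 : ℝ) 1, (∃ᶠ n in atTop, n ∈ S ∧ t ∈ Metric.ball (x n) (r n ^ α)) ∧
          ∀ j, t ∉ Metric.ball (a j) (ρ j) := by
  have hs1 : s < 1 := by nlinarith
  set c : ℝ := (1 / 80) ^ (s / (1 - s)) with hcdef
  have hc : 0 < c := by positivity
  have hc' : c ^ ((1 - s) / s) ≤ 1 / 80 := by
    rw [hcdef, ← Real.rpow_mul (by norm_num),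
      div_mul_div_cancel₀ (by linarith : (1 - s) ≠ 0), div_self hs.ne', Real.rpow_one]
  refine ⟨c / 2, by positivity, fun x r S hr hr0 hfull a ρ hρ hsum => ?_⟩
  have hunit : Set.Icc (0 : ℝ) 1 = Metric.closedBall (1 / 2) (1 / 2) := by
    rw [Real.closedBall_eq_Icc]; norm_num
  have hthin0 : IsThinOn s c a ρ (Metric.closedBall (1 / 2) (1 / 2)) := by
    intro F
    have hF : ∑ j ∈ F, ρ j ^ s ≤ c / 2 := by
      have h1 : ∑ j ∈ F, ENNReal.ofReal (ρ j ^ s) ≤ ENNReal.ofReal (c / 2) :=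
        (ENNReal.sum_le_tsum F).trans hsum.le
      rw [← ENNReal.ofReal_sum_of_nonneg fun j _ => Real.rpow_nonneg (hρ j) _] at h1
      exact (ENNReal.ofReal_le_ofReal_iff (by positivity)).1 h1
    have hterm : ∀ j, volume.real (Metric.ball (a j) (ρ j) ∩
        Metric.closedBall (1 / 2) (1 / 2)) ^ s ≤ 2 * ρ j ^ s := by
      intro j
      have h1 : volume.real (Metric.ball (a j) (ρ j) ∩ Metric.closedBall (1 / 2) (1 / 2)) ≤
          2 * ρ j := by
        have := measureReal_mono (μ := volume) (Set.inter_subset_left (s := Metric.ball (a j) (ρ j))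
          (t := Metric.closedBall (1 / 2) (1 / 2))) measure_ball_lt_top.ne
        rwa [Real.volume_real_ball (hρ j)] at this
      calc _ ≤ (2 * ρ j) ^ s := Real.rpow_le_rpow measureReal_nonneg h1 hs.le
        _ = 2 ^ s * ρ j ^ s := Real.mul_rpow zero_le_two (hρ j)
        _ ≤ 2 ^ (1 : ℝ) * ρ j ^ s := by
            have := Real.rpow_nonneg (hρ j) s
            gcongr
            norm_num
        _ = _ := by rw [Real.rpow_one]
    rw [Real.volume_real_closedBall (by norm_num)]
    calc _ ≤ ∑ j ∈ F, 2 * ρ j ^ s := Finset.sum_le_sum fun j _ => hterm j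
      _ = 2 * ∑ j ∈ F, ρ j ^ s := (Finset.mul_sum ..).symm
      _ ≤ c := by linarith
      _ = _ := by norm_num
  -- The indices of the balls among which the nested sequence is chosen.
  let P : ℕ → Prop := fun n => n ∈ S ∧
    Metric.closedBall (x n) (r n ^ α / 2) ⊆ Set.Icc (0 : ℝ) 1 ∧
    IsThinOn s c a ρ (Metric.closedBall (x n) (r n ^ α / 2))
  obtain ⟨n₀, -, hn₀S, hn₀sub, hn₀thin⟩ := IsThinOn.exists_closedBall hα hs hαs hc hc' hr hr0
    (by norm_num) (hunit ▸ hfull) hthin0 0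
  have hstep : ∀ n : {n // P n}, ∃ n' : {n // P n}, n.1 < n'.1 ∧
      Metric.closedBall (x n') (r n' ^ α / 2) ⊆ Metric.closedBall (x n) (r n ^ α / 2) := by
    rintro ⟨n, hnS, hnsub, hnthin⟩
    have hpos : 0 < r n ^ α / 2 := by have := hr n; positivity
    obtain ⟨n', hn', hnS', hsub', hthin'⟩ := IsThinOn.exists_closedBall hα hs hαs hc hc' hr hr0
      hpos (hfull.mono fun t ht h => ht (hnsub h)) hnthin (n + 1)
    exact ⟨⟨n', hnS', hsub'.trans hnsub, hthin'⟩, hn', hsub'⟩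
  choose next hlt hsub using hstep
  let f : ℕ → {n // P n} := fun i => next^[i] ⟨n₀, hn₀S, hunit ▸ hn₀sub, hn₀thin⟩
  have hf : ∀ i, f (i + 1) = next (f i) := fun i => Function.iterate_succ_apply' ..
  have hmono : StrictMono fun i => (f i).1 :=
    strictMono_nat_of_lt_succ fun i => by rw [hf]; exact hlt _
  obtain ⟨t, ht⟩ := IsCompact.nonempty_iInter_of_sequence_nonempty_isCompact_isClosed
    (fun i => Metric.closedBall (x (f i)) (r (f i) ^ α / 2))
    (fun i => by rw [hf]; exact hsub _)
    (fun i => ⟨x (f i), Metric.mem_closedBall_self (by have := hr (f i); positivity)⟩)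
    (isCompact_closedBall _ _) (fun i => Metric.isClosed_closedBall)
  rw [Set.mem_iInter] at ht
  refine ⟨t, (f 0).2.2.1 (ht 0), ?_, fun j hj => ?_⟩
  · refine Filter.frequently_atTop.2 fun N => ⟨f N, hmono.id_le N, (f N).2.1, ?_⟩
    have := Real.rpow_pos_of_pos (hr (f N)) α
    exact Metric.closedBall_subset_ball (by linarith) (ht N)
  -- The nested balls shrink to `t`, so one of them would be contained in the `j`-th interval,
  -- which thinness forbids.
  · obtain ⟨ε, hε, hεsub⟩ := Metric.isOpen_iff.1 Metric.isOpen_ball t hj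
    have hlim : Tendsto (fun i => r (f i) ^ α) atTop (𝓝 0) := by
      have := (hr0.comp hmono.tendsto_atTop).rpow_const (p := α) (Or.inr (by linarith))
      rwa [Real.zero_rpow (by linarith)] at this
    obtain ⟨i, hi⟩ := (hlim.eventually (eventually_lt_nhds hε)).exists
    have hsubj : Metric.closedBall (x (f i)) (r (f i) ^ α / 2) ⊆ Metric.ball (a j) (ρ j) := by
      refine fun z hz => hεsub ?_
      have h1 := Metric.mem_closedBall.1 hz
      have h2 := Metric.mem_closedBall'.1 (ht i)
      have := dist_triangle z (x (f i)) t
      exact Metric.mem_ball.2 (by linarith)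
    have hthin := (f i).2.2.2 {j}
    have hpos := Real.rpow_pos_of_pos (hr (f i)) α
    rw [Finset.sum_singleton, Set.inter_eq_right.2 hsubj,
      Real.volume_real_closedBall (by positivity), mul_div_cancel₀ _ two_ne_zero] at hthin
    have hc1 : c < 1 := Real.rpow_lt_one (by norm_num) (by norm_num)
      (div_pos hs (by linarith))
    have := Real.rpow_pos_of_pos hpos s
    nlinarith

/-! ### Slicing of Hausdorff measure -/

/-- A set of `d`-dimensional Hausdorff measure zero is covered by open balls with
arbitrarily small sum of the `d`-th powers of the radii. -/
lemma exists_ball_cover_of_hausdorffMeasure_eq_zero {X : Type*} [MetricSpace X]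
    [MeasurableSpace X] [BorelSpace X] [Nonempty X] {d : ℝ} (hd : 0 < d) {F : Set X}
    (hF : Measure.hausdorffMeasure d F = 0) {ε : ENNReal} (hε : ε ≠ 0) :
    ∃ (a : ℕ → X) (ρ : ℕ → ℝ), (∀ j, 0 < ρ j) ∧ F ⊆ ⋃ j, Metric.ball (a j) (ρ j) ∧
      ∑' j, ENNReal.ofReal (ρ j ^ d) < ε := by
  have hε2 : ε / 2 ≠ 0 := (ENNReal.half_pos hε).ne'
  rw [Measure.hausdorffMeasure_apply, ENNReal.iSup_eq_zero] at hF
  have h1 := ENNReal.iSup_eq_zero.1 (hF 1) one_pos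
  have h2 := h1.trans_lt (pos_iff_ne_zero.2 hε2)
  simp only [iInf_lt_iff] at h2
  obtain ⟨t, hFt, hdiam, hsum⟩ := h2
  obtain ⟨δ, hδ, hδsum⟩ := ENNReal.exists_pos_sum_of_countable hε2 ℕ
  have hball : ∀ j, ∃ (a : X) (ρ : ℝ), 0 < ρ ∧ t j ⊆ Metric.ball a ρ ∧
      ENNReal.ofReal (ρ ^ d) ≤ (⨆ _ : (t j).Nonempty, Metric.ediam (t j) ^ d) + δ j := by
    intro j
    have hlim : Tendsto (fun e : ℝ => (Metric.diam (t j) + e) ^ d) (𝓝[>] 0)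
        (𝓝 (Metric.diam (t j) ^ d)) := by
      have : Tendsto (fun e : ℝ => Metric.diam (t j) + e) (𝓝 0) (𝓝 (Metric.diam (t j) + 0)) :=
        tendsto_const_nhds.add tendsto_id
      rw [add_zero] at this
      exact (this.rpow_const (Or.inr hd.le)).mono_left nhdsWithin_le_nhds
    obtain ⟨e, he, he0⟩ := ((hlim.eventually (eventually_lt_nhds
      (lt_add_of_pos_right _ (NNReal.coe_pos.2 (hδ j))))).and self_mem_nhdsWithin).exists
    have he0 : 0 < e := he0
    have hdfin : Metric.ediam (t j) ≠ ⊤ := ((hdiam j).trans_lt ENNReal.one_lt_top).ne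
    by_cases hne : (t j).Nonempty
    · rw [iSup_pos hne]
      obtain ⟨a, ha⟩ := hne
      refine ⟨a, Metric.diam (t j) + e, by have := Metric.diam_nonneg (s := t j); linarith,
        fun z hz => Metric.mem_ball.2 ?_, ?_⟩
      · have := Metric.dist_le_diam_of_mem (Metric.isBounded_iff_ediam_ne_top.2 hdfin) hz ha
        linarith
      · calc _ ≤ ENNReal.ofReal (Metric.diam (t j) ^ d + δ j) := ENNReal.ofReal_le_ofReal he.le
          _ ≤ ENNReal.ofReal (Metric.diam (t j) ^ d) + ENNReal.ofReal (δ j) :=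
            ENNReal.ofReal_add_le
          _ = _ := by
            rw [← ENNReal.ofReal_rpow_of_nonneg Metric.diam_nonneg hd.le, Metric.diam,
              ENNReal.ofReal_toReal hdfin, ENNReal.ofReal_coe_nnreal]
    · rw [Set.not_nonempty_iff_eq_empty] at hne
      refine ⟨Classical.arbitrary X, e, he0, by simp [hne], ?_⟩
      simp only [hne, Metric.diam_empty, Real.zero_rpow hd.ne', zero_add] at he
      calc _ ≤ ENNReal.ofReal (δ j) := ENNReal.ofReal_le_ofReal he.le
        _ = δ j := ENNReal.ofReal_coe_nnreal
        _ ≤ _ := le_add_self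
  choose a ρ hρ hsub hle using hball
  refine ⟨a, ρ, hρ, hFt.trans (Set.iUnion_mono hsub), ?_⟩
  calc ∑' j, ENNReal.ofReal (ρ j ^ d)
      ≤ ∑' j, ((⨆ _ : (t j).Nonempty, Metric.ediam (t j) ^ d) + δ j) := ENNReal.tsum_le_tsum hle
    _ = (∑' j, ⨆ _ : (t j).Nonempty, Metric.ediam (t j) ^ d) + ∑' j, (δ j : ENNReal) :=
        ENNReal.tsum_add
    _ < ε / 2 + ε / 2 := ENNReal.add_lt_add hsum hδsum
    _ = ε := ENNReal.add_halves ε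

/-- Integrating the `s`-th powers of the radii of the balls of a cover that meet a slice: on some
slice over the cube, the sum is controlled by the sum of the `(s + m)`-th powers. -/
lemma exists_slice_tsum_lt {m : ℕ} {s c : ℝ} {b : ℕ → Fin m → ℝ} {ρ : ℕ → ℝ}
    (hρ : ∀ j, 0 < ρ j)
    (hsum : ∑' j, ENNReal.ofReal (ρ j ^ (s + m)) < ENNReal.ofReal (c / 2 ^ m))
    {p : (Fin m → ℝ) → Prop}
    (hp : ∀ᵐ y : Fin m → ℝ, y ∈ Set.Icc (0 : Fin m → ℝ) 1 → p y) :
    ∃ y ∈ Set.Icc (0 : Fin m → ℝ) 1, p y ∧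
      ∑' j, (Metric.closedBall (b j) (ρ j)).indicator (fun _ => ENNReal.ofReal (ρ j ^ s)) y <
        ENNReal.ofReal c := by
  by_contra! hcon
  have hint : ∫⁻ y, ∑' j, (Metric.closedBall (b j) (ρ j)).indicator
      (fun _ => ENNReal.ofReal (ρ j ^ s)) y =
        ENNReal.ofReal (2 ^ m) * ∑' j, ENNReal.ofReal (ρ j ^ (s + m)) := by
    rw [lintegral_tsum fun j =>
      (measurable_const.indicator measurableSet_closedBall).aemeasurable, ← ENNReal.tsum_mul_left]
    congr 1
    ext j
    rw [lintegral_indicator_const measurableSet_closedBall, Real.volume_pi_closedBall _ (hρ j).le,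
      Fintype.card_fin, ← ENNReal.ofReal_mul (Real.rpow_nonneg (hρ j).le _),
      ← ENNReal.ofReal_mul (by positivity), Real.rpow_add (hρ j), Real.rpow_natCast]
    congr 1
    ring
  have hcube : volume (Set.Icc (0 : Fin m → ℝ) 1) = 1 := by
    rw [Real.volume_Icc_pi]; simp
  have hlow : ENNReal.ofReal c ≤ ∫⁻ y, ∑' j, (Metric.closedBall (b j) (ρ j)).indicator
      (fun _ => ENNReal.ofReal (ρ j ^ s)) y := by
    calc ENNReal.ofReal c = ∫⁻ _ in Set.Icc (0 : Fin m → ℝ) 1, ENNReal.ofReal c := by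
          rw [setLIntegral_const, hcube, mul_one]
      _ ≤ ∫⁻ y in Set.Icc (0 : Fin m → ℝ) 1, ∑' j, (Metric.closedBall (b j) (ρ j)).indicator
            (fun _ => ENNReal.ofReal (ρ j ^ s)) y := by
          refine lintegral_mono_ae ((ae_restrict_iff' measurableSet_Icc).2 ?_)
          filter_upwards [hp] with y hy hyI using hcon y hyI (hy hyI)
      _ ≤ _ := setLIntegral_le_lintegral _ _
  rw [hint] at hlow
  refine absurd hlow (not_le.2 ?_)
  calc _ < ENNReal.ofReal (2 ^ m) * ENNReal.ofReal (c / 2 ^ m) :=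
        ENNReal.mul_lt_mul_right (by simp) ENNReal.ofReal_ne_top hsum
    _ = ENNReal.ofReal c := by
        rw [← ENNReal.ofReal_mul (by positivity), mul_div_cancel₀ _ (by positivity)]

/-- The point of `ℝ^(m+1)` with first coordinate `t` and remaining coordinates `y`. -/
noncomputable def consPoint {m : ℕ} (y : Fin m → ℝ) (t : ℝ) : EuclideanSpace ℝ (Fin (m + 1)) :=
  WithLp.toLp 2 (Fin.cons t y)

@[simp] lemma consPoint_zero {m : ℕ} (y : Fin m → ℝ) (t : ℝ) : consPoint y t 0 = t := rfl

@[simp] lemma consPoint_succ {m : ℕ} (y : Fin m → ℝ) (t : ℝ) (i : Fin m) :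
    consPoint y t i.succ = y i := rfl

lemma measurePreserving_consPoint (m : ℕ) :
    MeasurePreserving (fun p : (Fin m → ℝ) × ℝ => consPoint p.1 p.2) := by
  have h1 := (volume_preserving_piFinSuccAbove (fun _ : Fin (m + 1) => ℝ) 0).symm
  have h2 := (PiLp.volume_preserving_toLp (Fin (m + 1))).comp
    (h1.comp (Measure.measurePreserving_swap (μ := (volume : Measure (Fin m → ℝ)))
      (ν := (volume : Measure ℝ))))
  have h3 : (fun p : (Fin m → ℝ) × ℝ => consPoint p.1 p.2) = WithLp.toLp 2 ∘
      (MeasurableEquiv.piFinSuccAbove (fun _ : Fin (m + 1) => ℝ) 0).symm ∘ Prod.swap := by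
    funext p
    change _ = WithLp.toLp 2 (Fin.insertNth (α := fun _ => ℝ) 0 p.2 p.1)
    rw [Fin.insertNth_zero', consPoint]
  rw [h3]
  exact h2

lemma consPoint_mem_unitCube {m : ℕ} {y : Fin m → ℝ} {t : ℝ} :
    consPoint y t ∈ unitCube (m + 1) ↔ y ∈ Set.Icc (0 : Fin m → ℝ) 1 ∧ t ∈ Set.Icc (0 : ℝ) 1 := by
  simp only [unitCube, Set.mem_ofPred_eq, Fin.forall_fin_succ, consPoint_zero, consPoint_succ,
    Set.mem_Icc, Pi.le_def, Pi.zero_apply, Pi.one_apply, forall_and]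
  tauto

/-- Lower bound for the dimension of a limsup set of products of intervals `B(x n, r n)` and
arbitrary sets `Q n` when only the intervals are shrunk. A cover witnessing that
the Hausdorff measure vanishes would, on some slice in the direction of the first coordinate,
contradict the one-dimensional principle. -/
theorem le_dimH_limsup_prod {m : ℕ} {α : ℝ} (hα : 1 < α) {x r : ℕ → ℝ} (hr : ∀ n, 0 < r n)
    (hr0 : Tendsto r atTop (𝓝 0)) (Q : ℕ → Set (Fin m → ℝ))
    (hfull : ∀ᵐ z : EuclideanSpace ℝ (Fin (m + 1)), z ∈ unitCube (m + 1) →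
      ∃ᶠ n in atTop, (fun i : Fin m => z i.succ) ∈ Q n ∧ z 0 ∈ Metric.closedBall (x n) (r n)) :
    ENNReal.ofReal (1 / α + m) ≤ dimH {z : EuclideanSpace ℝ (Fin (m + 1)) |
      z ∈ unitCube (m + 1) ∧ ∃ᶠ n in atTop,
        (fun i : Fin m => z i.succ) ∈ Q n ∧ z 0 ∈ Metric.ball (x n) (r n ^ α)} := by
  set F := {z : EuclideanSpace ℝ (Fin (m + 1)) | z ∈ unitCube (m + 1) ∧ ∃ᶠ n in atTop,
        (fun i : Fin m => z i.succ) ∈ Q n ∧ z 0 ∈ Metric.ball (x n) (r n ^ α)}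
  have hslice : ∀ᵐ y : Fin m → ℝ, y ∈ Set.Icc (0 : Fin m → ℝ) 1 →
      ∀ᵐ t : ℝ, t ∈ Set.Icc (0 : ℝ) 1 →
        ∃ᶠ n in atTop, n ∈ {n | y ∈ Q n} ∧ t ∈ Metric.closedBall (x n) (r n) := by
    have h := Measure.ae_ae_of_ae_prod
      ((measurePreserving_consPoint m).quasiMeasurePreserving.ae hfull)
    filter_upwards [h] with y hy hyI
    filter_upwards [hy] with t ht htI
    exact ht (consPoint_mem_unitCube.2 ⟨hyI, htI⟩)
  have hmain : ∀ s : ℝ, 0 < s → s < 1 / α → ENNReal.ofReal (s + m) ≤ dimH F := by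
    intro s hs hsα
    have hαs : α * s < 1 := by rwa [mul_comm, ← lt_div_iff₀ (by linarith)]
    have hd : 0 < s + m := by positivity
    refine le_dimH_of_hausdorffMeasure_ne_zero fun h0 => ?_
    rw [Real.coe_toNNReal _ hd.le] at h0
    obtain ⟨c, hc, hcov⟩ := exists_mem_limsup_ball_notMem hα hs hαs
    obtain ⟨a, ρ, hρ, hFsub, hsum⟩ := exists_ball_cover_of_hausdorffMeasure_eq_zero hd h0
      (ε := ENNReal.ofReal (c / 2 ^ m)) (ENNReal.ofReal_pos.2 (by positivity)).ne'
    obtain ⟨y, hyI, hy, hlt⟩ :=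
      exists_slice_tsum_lt (b := fun j i => a j i.succ) hρ hsum hslice
    classical
    -- On the slice over `y`, balls that miss the slice are replaced by empty ones.
    let ρ' : ℕ → ℝ := fun j =>
      if y ∈ Metric.closedBall (fun i : Fin m => a j i.succ) (ρ j) then ρ j else 0
    obtain ⟨t, htI, htfr, htn⟩ := hcov x r {n | y ∈ Q n} hr hr0 hy (fun j => a j 0) ρ'
      (fun j => by simp only [ρ']; split_ifs <;> [exact (hρ j).le; rfl]) (by
        convert hlt using 3 with j
        simp only [ρ', Set.indicator_apply]
        split_ifs <;> simp [Real.zero_rpow hs.ne'])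
    have hmem : consPoint y t ∈ F := ⟨consPoint_mem_unitCube.2 ⟨hyI, htI⟩, htfr⟩
    obtain ⟨j, hj⟩ := Set.mem_iUnion.1 (hFsub hmem)
    rw [Metric.mem_ball] at hj
    have hcoord : ∀ i, dist (consPoint y t i) (a j i) < ρ j := fun i =>
      (PiLp.dist_apply_le (p := 2) _ _ i).trans_lt hj
    have hyj : y ∈ Metric.closedBall (fun i : Fin m => a j i.succ) (ρ j) :=
      (dist_pi_le_iff (hρ j).le).2 fun i => (hcoord i.succ).le
    refine htn j ?_
    simp only [ρ', if_pos hyj]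
    exact hcoord 0
  by_contra! hcon
  obtain ⟨d, hd1, hd2⟩ := ENNReal.lt_iff_exists_nnreal_btwn.1 hcon
  have hd2' : (d : ℝ) < 1 / α + m := by
    rw [← ENNReal.ofReal_coe_nnreal] at hd2
    exact (ENNReal.ofReal_lt_ofReal_iff'.1 hd2).1
  have hα0 : 0 < 1 / α := by positivity
  refine absurd (hmain (max (d - m) (1 / α / 2)) (lt_max_of_lt_right (by positivity))
    (max_lt (by linarith) (by linarith))) (not_le.2 (hd1.trans_le ?_))
  rw [← ENNReal.ofReal_coe_nnreal]
  exact ENNReal.ofReal_le_ofReal (by linarith [le_max_left ((d : ℝ) - m) (1 / α / 2)])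

/-! ### Rectangles in the unit cube -/

lemma volume_unitCube (k : ℕ) : volume (unitCube k) = 1 := by
  have h : unitCube k = (WithLp.ofLp : EuclideanSpace ℝ (Fin k) → Fin k → ℝ) ⁻¹' Set.Icc 0 1 := by
    ext z
    simp only [unitCube, Set.mem_ofPred_eq, Set.mem_preimage, Set.mem_Icc, Pi.le_def,
      Pi.zero_apply, Pi.one_apply, forall_and]
  rw [h, (PiLp.volume_preserving_ofLp (Fin k)).measure_preimage
    measurableSet_Icc.nullMeasurableSet, Real.volume_Icc_pi]
  simp

lemma ae_mem_limsup_of_volume_eq_one {k : ℕ} {H : ℕ → Set (EuclideanSpace ℝ (Fin k))}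
    (hH : ∀ n, MeasurableSet (H n)) (h : volume (limsup H atTop ∩ unitCube k) = 1) :
    ∀ᵐ z, z ∈ unitCube k → ∃ᶠ n in atTop, z ∈ H n := by
  have hm : MeasurableSet (unitCube k) := by
    simp only [unitCube, Set.ofPred_forall]
    exact MeasurableSet.iInter fun i =>
      measurableSet_Icc.preimage (EuclideanSpace.proj (𝕜 := ℝ) i).continuous.measurable
  have hae : (limsup H atTop ∩ unitCube k : Set _) =ᵐ[volume] unitCube k :=
    ae_eq_of_subset_of_measure_ge Set.inter_subset_right (by rw [h, volume_unitCube])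
      ((MeasurableSet.measurableSet_limsup hH).inter hm).nullMeasurableSet
      (by rw [volume_unitCube]; exact ENNReal.one_ne_top)
  filter_upwards [hae] with z hz hzc
  exact mem_limsup_iff_frequently_mem.1 (hz.mpr hzc).1

lemma measurableSet_rectangle {k : ℕ} (x : EuclideanSpace ℝ (Fin k)) (r : Fin k → ℝ) :
    MeasurableSet (rectangle x r) := by
  simp only [rectangle, Set.ofPred_forall]
  exact MeasurableSet.iInter fun i =>
    measurableSet_ball.preimage (EuclideanSpace.proj (𝕜 := ℝ) i).continuous.measurable

lemma measurableSet_closedRectangle {k : ℕ} (x : EuclideanSpace ℝ (Fin k)) (r : Fin k → ℝ) :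
    MeasurableSet (closedRectangle x r) := by
  simp only [closedRectangle, Set.ofPred_forall]
  exact MeasurableSet.iInter fun i =>
    measurableSet_closedBall.preimage (EuclideanSpace.proj (𝕜 := ℝ) i).continuous.measurable

theorem mainTheorem4 (k : ℕ) [NeZero k] (α : ℝ) (hα : 1 < α)
    (x : ℕ → EuclideanSpace ℝ (Fin k)) (hx : ∀ n, x n ∈ unitCube k)
    (r : ℕ → Fin k → ℝ) (hr : ∀ n i, 0 < r n i)
    (hr0 : Tendsto (fun n => r n 0) atTop (𝓝 0)) :
    (volume (limsup (fun n => rectangle (x n) (r n)) atTop ∩ unitCube k) = 1 →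
      ENNReal.ofReal (1 / α + (k : ℝ) - 1) ≤
        dimH (limsup (fun n => rectangle (x n) (shrinkFirst α (r n))) atTop ∩ unitCube k)) ∧
    (volume (limsup (fun n => closedRectangle (x n) (r n)) atTop ∩ unitCube k) = 1 →
      ENNReal.ofReal (1 / α + (k : ℝ) - 1) ≤
        dimH (limsup (fun n => closedRectangle (x n) (shrinkFirst α (r n))) atTop ∩
          unitCube k)) := by
  obtain ⟨m, rfl⟩ := Nat.exists_eq_succ_of_ne_zero (NeZero.ne k)
  have hexp : 1 / α + ((m + 1 : ℕ) : ℝ) - 1 = 1 / α + m := by push_cast; ring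
  simp only [Nat.succ_eq_add_one, hexp] at *
  refine ⟨fun h => ?_, fun h => ?_⟩
  · refine (le_dimH_limsup_prod hα (x := fun n => x n 0) (fun n => hr n 0) hr0
      (fun n => {y | ∀ i, y i ∈ Metric.ball (x n i.succ) (r n i.succ)}) ?_).trans (dimH_mono ?_)
    · filter_upwards [ae_mem_limsup_of_volume_eq_one
        (fun n => measurableSet_rectangle (x n) (r n)) h] with z hz hzc
      exact (hz hzc).mono fun n hn =>
        ⟨fun i => hn i.succ, Metric.ball_subset_closedBall (hn 0)⟩
    · rintro z ⟨hzc, hz⟩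
      refine ⟨mem_limsup_iff_frequently_mem.2 (hz.mono fun n hn => ?_), hzc⟩
      refine Fin.forall_fin_succ.2 ⟨?_, fun i => ?_⟩
      · simpa [shrinkFirst] using hn.2
      · simpa [shrinkFirst] using hn.1 i
  · refine (le_dimH_limsup_prod hα (x := fun n => x n 0) (fun n => hr n 0) hr0
      (fun n => {y | ∀ i, y i ∈ Metric.closedBall (x n i.succ) (r n i.succ)}) ?_).trans
        (dimH_mono ?_)
    · filter_upwards [ae_mem_limsup_of_volume_eq_one
        (fun n => measurableSet_closedRectangle (x n) (r n)) h] with z hz hzc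
      exact (hz hzc).mono fun n hn => ⟨fun i => hn i.succ, hn 0⟩
    · rintro z ⟨hzc, hz⟩
      refine ⟨mem_limsup_iff_frequently_mem.2 (hz.mono fun n hn => ?_), hzc⟩
      refine Fin.forall_fin_succ.2 ⟨?_, fun i => ?_⟩
      · have := Metric.ball_subset_closedBall hn.2
        simpa [shrinkFirst] using this
      · simpa [shrinkFirst] using hn.1 i
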